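/- Let $m,n\ge 0$ and $r\ge 1$ be integers, and let $f:\mathbb{R}^{m\times n}\to\mathbb{R}$ be twice differentiable with gradient $\nabla f(X)\in\mathbb{R}^{m\times n}$. Write $\langle\cdot,\cdot\rangle$ and $\|\cdot\|_F$ for the Frobenius inner product and norm. Let $\alpha,\beta>0$, and assume that for all $X,Y\in\mathbb{R}^{m\times n}$ with $\operatorname{rank}(X),\operatorname{rank}(Y)\le r$, $$f(X)+\langle\nabla f(X),Y-X\rangle+\tfrac{\alpha}{2}\|X-Y\|_F^2\;\le\; f(Y)\;\le\; f(X)+\langle\nabla f(X),Y-X\rangle+\tfrac{\beta}{2}\|X-Y\|_F^2$$ ($\alpha$-restricted strong convexity and $\beta$-restricted smoothness with respect to rank $r$). Put $\kappa=\beta/\alpha$. Then the minimum $\min_{\operatorname{rank}(Y)<r/\kappa^2}f(Y)$ over $Y\in\mathbb{R}^{m\times n}$ is attained, and: 1. If $X\in\mathbb{R}^{m\times n}$ is a stationary point of projected gradient descent with rank constraint $r$ and step size $\eta=1/\beta$, that is, $\operatorname{rank}(X)\le r$ and $X\in\arg\min_{\operatorname{rank}(X')\le r}\|X'-(X-\eta\nabla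 f(X))\|_F$, then $$f(X)\le\min_{\operatorname{rank}(Y)<r/\kappa^2}f(Y).$$ 2. If $(A,B)\in\mathbb{R}^{m\times r}\times\mathbb{R}^{n\times r}$ is a second-order stationary point of the factorized objective $g(A,B)=f(AB^\top)$, that is, $\nabla g(A,B)=0$ and $\nabla^2 g(A,B)\succeq 0$, then $$f(AB^\top)\le\min_{\operatorname{rank}(Y)<r/\kappa^2}f(Y).$$ -/

import Mathlib

namespace LowRankOpt

open scoped Matrix Matrix.Norms.Frobenius

variable {m n r : ℕ}

/-- The Frobenius inner product `⟨G, H⟩ = ∑ᵢⱼ Gᵢⱼ Hᵢⱼ`. -/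
def frobInner (G H : Matrix (Fin m) (Fin n) ℝ) : ℝ :=
  ∑ i, ∑ j, G i j * H i j

/-- `f` is twice (Fréchet) differentiable on the whole matrix space. -/
def TwiceDifferentiable (f : Matrix (Fin m) (Fin n) ℝ → ℝ) : Prop :=
  Differentiable ℝ f ∧ Differentiable ℝ (fderiv ℝ f)

/-- The gradient of `f` at `X`, as the matrix of partial derivatives. -/
noncomputable def gradMatrix (f : Matrix (Fin m) (Fin n) ℝ → ℝ)
    (X : Matrix (Fin m) (Fin n) ℝ) : Matrix (Fin m) (Fin n) ℝ :=
  Matrix.of fun i j => fderiv ℝ f X (Matrix.single i j 1)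

/-- `α`-restricted strong convexity with respect to the rank constraint `r`;
`‖·‖` is the Frobenius norm. -/
def RestrictedStronglyConvex (f : Matrix (Fin m) (Fin n) ℝ → ℝ) (r : ℕ) (α : ℝ) : Prop :=
  ∀ X Y : Matrix (Fin m) (Fin n) ℝ, X.rank ≤ r → Y.rank ≤ r →
    f X + frobInner (gradMatrix f X) (Y - X) + α / 2 * ‖X - Y‖ ^ 2 ≤ f Y

/-- `β`-restricted smoothness with respect to the rank constraint `r`. -/
def RestrictedSmooth (f : Matrix (Fin m) (Fin n) ℝ → ℝ) (r : ℕ) (β : ℝ) : Prop :=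
  ∀ X Y : Matrix (Fin m) (Fin n) ℝ, X.rank ≤ r → Y.rank ≤ r →
    f Y ≤ f X + frobInner (gradMatrix f X) (Y - X) + β / 2 * ‖X - Y‖ ^ 2

/-- `X` is a (possibly non-unique) Frobenius-norm projection of `Z` to the set of matrices of
rank at most `r`. -/
def IsRankProjection (r : ℕ) (Z X : Matrix (Fin m) (Fin n) ℝ) : Prop :=
  X.rank ≤ r ∧ ∀ X' : Matrix (Fin m) (Fin n) ℝ, X'.rank ≤ r → ‖X - Z‖ ≤ ‖X' - Z‖

/-- `X` is a stationary point of projected gradient descent on `f` with rank constraint `r` and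
step size `η`. -/
def IsPGDStationary (f : Matrix (Fin m) (Fin n) ℝ → ℝ) (r : ℕ) (η : ℝ)
    (X : Matrix (Fin m) (Fin n) ℝ) : Prop :=
  IsRankProjection r (X - η • gradMatrix f X) X

/-- The factorized objective `g (A, B) = f (A Bᵀ)`. -/
def factorized (f : Matrix (Fin m) (Fin n) ℝ → ℝ) (r : ℕ) :
    Matrix (Fin m) (Fin r) ℝ × Matrix (Fin n) (Fin r) ℝ → ℝ :=
  fun p => f (p.1 * p.2ᵀ)

/-- `p = (A, B)` is a second-order stationary point of the factorized problem: the derivative of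
the factorized objective vanishes at `p` and its second derivative there is positive
semidefinite. -/
def IsFactorizedSOSP (f : Matrix (Fin m) (Fin n) ℝ → ℝ) (r : ℕ)
    (p : Matrix (Fin m) (Fin r) ℝ × Matrix (Fin n) (Fin r) ℝ) : Prop :=
  fderiv ℝ (factorized f r) p = 0 ∧
    ∀ d : Matrix (Fin m) (Fin r) ℝ × Matrix (Fin n) (Fin r) ℝ,
      0 ≤ fderiv ℝ (fderiv ℝ (factorized f r)) p d d

end LowRankOpt

namespace LowRankOpt

open scoped Matrix Matrix.Norms.Frobenius
open Matrix Filter Topology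

/-! ### Frobenius geometry and orthonormal column bases. -/

section FrobeniusInner

variable {m n k : ℕ}

/-! Write `G` for the gradient at `X`. Both kinds of stationary point have one common property,
`IsSpectrallyStationary`: `G` is orthogonal to the row and column spaces of `X`, and its operator
norm is at most `β σ_r(X)`. Everything after that uses only this property and strong convexity.

Completing the square in the strong convexity bound at `X`, and projecting off the column space of
`Y` (orthonormal basis `P`), reduces `f X ≤ f Y` to `‖PᵀG‖² ≤ α² ‖X - PPᵀX‖²`
(`lower_model_nonneg`). Let `W` be an orthonormal basis of the column space of `X`, let `s = rank
Y`, `p = ‖PᵀW‖²`, and let `c` separate the squared singular values of `G` from those of `βX`. The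
left side is at most `c (s - p)`, because only the part of `P` orthogonal to `W` sees `G`; the right
side is at least `(α²/β²) c (r - p)`. The rank condition `s β² ≤ r α²` together with `α ≤ β`
compares the two (`norm_proj_sq_le`).

Spectral stationarity comes from explicit perturbations: rank-preserving or rank-exchanging ones for
projected gradient descent, and curvature along chosen directions for the factorized problem. No
singular value decomposition is used; singular values appear only through Rayleigh quotients. -/

theorem frobInner_eq_trace (G H : Matrix (Fin m) (Fin n) ℝ) :
    frobInner G H = (Gᵀ * H).trace := by
  simp only [frobInner, Matrix.trace, Matrix.diag, Matrix.mul_apply, Matrix.transpose_apply]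
  exact Finset.sum_comm

theorem frobInner_comm (G H : Matrix (Fin m) (Fin n) ℝ) : frobInner G H = frobInner H G := by
  simp only [frobInner, mul_comm]

theorem frobInner_add_right (G H K : Matrix (Fin m) (Fin n) ℝ) :
    frobInner G (H + K) = frobInner G H + frobInner G K := by
  simp [frobInner_eq_trace, Matrix.mul_add]

theorem frobInner_sub_right (G H K : Matrix (Fin m) (Fin n) ℝ) :
    frobInner G (H - K) = frobInner G H - frobInner G K := by
  simp [frobInner_eq_trace, Matrix.mul_sub]

theorem frobInner_smul_right (c : ℝ) (G H : Matrix (Fin m) (Fin n) ℝ) :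
    frobInner G (c • H) = c * frobInner G H := by
  simp [frobInner_eq_trace]

theorem frobInner_mul_right (A : Matrix (Fin m) (Fin k) ℝ) (B : Matrix (Fin k) (Fin n) ℝ)
    (C : Matrix (Fin m) (Fin n) ℝ) : frobInner C (A * B) = frobInner (Aᵀ * C) B := by
  simp [frobInner_eq_trace, Matrix.mul_assoc]

theorem frobInner_mul_right' (A : Matrix (Fin m) (Fin k) ℝ) (B : Matrix (Fin k) (Fin n) ℝ)
    (C : Matrix (Fin m) (Fin n) ℝ) : frobInner C (A * B) = frobInner (C * Bᵀ) A := by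
  rw [frobInner_eq_trace, frobInner_eq_trace, Matrix.transpose_mul, Matrix.transpose_transpose,
    ← Matrix.mul_assoc, Matrix.trace_mul_comm, Matrix.mul_assoc]

theorem frobInner_vecMulVec (C : Matrix (Fin m) (Fin n) ℝ) (u : Fin m → ℝ) (v : Fin n → ℝ) :
    frobInner C (vecMulVec u v) = (u ᵥ* C) ⬝ᵥ v := by
  simp only [frobInner, vecMulVec_apply, dotProduct, vecMul, Finset.sum_mul]
  rw [Finset.sum_comm]
  exact Finset.sum_congr rfl fun _ _ => Finset.sum_congr rfl fun _ _ => by ring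

theorem norm_sq_eq_frobInner (M : Matrix (Fin m) (Fin n) ℝ) : ‖M‖ ^ 2 = frobInner M M := by
  rw [Matrix.frobenius_norm_def, ← Real.sqrt_eq_rpow, Real.sq_sqrt (by positivity)]
  simp [frobInner, pow_two]

theorem norm_sq_eq_sum_dotProduct (M : Matrix (Fin m) (Fin n) ℝ) :
    ‖M‖ ^ 2 = ∑ i, M i ⬝ᵥ M i := norm_sq_eq_frobInner M

theorem norm_add_sq_frob (M N : Matrix (Fin m) (Fin n) ℝ) :
    ‖M + N‖ ^ 2 = ‖M‖ ^ 2 + 2 * frobInner M N + ‖N‖ ^ 2 := by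
  rw [norm_sq_eq_frobInner, norm_sq_eq_frobInner, norm_sq_eq_frobInner, frobInner_add_right,
    frobInner_comm (M + N), frobInner_comm (M + N), frobInner_add_right, frobInner_add_right,
    frobInner_comm N M]
  ring

theorem norm_sub_sq_frob (M N : Matrix (Fin m) (Fin n) ℝ) :
    ‖M - N‖ ^ 2 = ‖M‖ ^ 2 - 2 * frobInner M N + ‖N‖ ^ 2 := by
  rw [norm_sq_eq_frobInner, norm_sq_eq_frobInner, norm_sq_eq_frobInner, frobInner_sub_right,
    frobInner_comm (M - N), frobInner_comm (M - N), frobInner_sub_right, frobInner_sub_right,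
    frobInner_comm N M]
  ring

theorem norm_sq_vecMulVec (u : Fin m → ℝ) (v : Fin n → ℝ) :
    ‖vecMulVec u v‖ ^ 2 = (u ⬝ᵥ u) * (v ⬝ᵥ v) := by
  rw [norm_sq_eq_frobInner, frobInner_vecMulVec, vecMul_vecMulVec, smul_dotProduct]
  rfl

theorem eq_zero_of_frobInner_eq_zero {M : Matrix (Fin m) (Fin n) ℝ}
    (h : ∀ H, frobInner M H = 0) : M = 0 := by
  have := h M
  rw [← norm_sq_eq_frobInner] at this
  exact norm_eq_zero.1 (pow_eq_zero_iff two_ne_zero |>.1 this)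

/-- The squared Frobenius norm is a sum over rows, so a Rayleigh quotient bound for `G` applies row
by row. -/
theorem norm_mul_sq_le {c : ℝ} {G : Matrix (Fin m) (Fin n) ℝ}
    (h : ∀ u, (u ᵥ* G) ⬝ᵥ (u ᵥ* G) ≤ c * (u ⬝ᵥ u)) (N : Matrix (Fin k) (Fin m) ℝ) :
    ‖N * G‖ ^ 2 ≤ c * ‖N‖ ^ 2 := by
  rw [norm_sq_eq_sum_dotProduct, norm_sq_eq_sum_dotProduct, Finset.mul_sum]
  exact Finset.sum_le_sum fun i _ => h (N i)

theorem le_norm_mul_sq {c : ℝ} {G : Matrix (Fin m) (Fin n) ℝ}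
    (h : ∀ u, c * (u ⬝ᵥ u) ≤ (u ᵥ* G) ⬝ᵥ (u ᵥ* G)) (N : Matrix (Fin k) (Fin m) ℝ) :
    c * ‖N‖ ^ 2 ≤ ‖N * G‖ ^ 2 := by
  rw [norm_sq_eq_sum_dotProduct, norm_sq_eq_sum_dotProduct, Finset.mul_sum]
  exact Finset.sum_le_sum fun i _ => h (N i)

theorem norm_transpose_frob (M : Matrix (Fin m) (Fin n) ℝ) : ‖Mᵀ‖ = ‖M‖ :=
  Matrix.frobenius_norm_transpose M

/-- Pythagoras for the orthogonal projection `P Pᵀ`. -/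
theorem norm_sq_sub_proj {P : Matrix (Fin m) (Fin k) ℝ} (hP : Pᵀ * P = 1)
    (M : Matrix (Fin m) (Fin n) ℝ) :
    ‖M - P * (Pᵀ * M)‖ ^ 2 = ‖M‖ ^ 2 - ‖Pᵀ * M‖ ^ 2 := by
  have h1 : frobInner M (P * (Pᵀ * M)) = ‖Pᵀ * M‖ ^ 2 := by
    rw [frobInner_mul_right, norm_sq_eq_frobInner]
  have h2 : ‖P * (Pᵀ * M)‖ ^ 2 = ‖Pᵀ * M‖ ^ 2 := by
    rw [norm_sq_eq_frobInner, frobInner_mul_right, ← Matrix.mul_assoc, hP, Matrix.one_mul,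
      norm_sq_eq_frobInner]
  rw [norm_sub_sq_frob, h1, h2]
  ring

theorem norm_sq_of_orthonormal {P : Matrix (Fin m) (Fin k) ℝ} (hP : Pᵀ * P = 1) :
    ‖P‖ ^ 2 = k := by
  rw [norm_sq_eq_frobInner, frobInner_eq_trace, hP]
  simp

/-- A matrix whose columns form an orthonormal basis of the column space. -/
theorem exists_orthonormal_factor (M : Matrix (Fin m) (Fin n) ℝ) :
    ∃ (W : Matrix (Fin m) (Fin M.rank) ℝ) (K : Matrix (Fin n) (Fin M.rank) ℝ),
      Wᵀ * W = 1 ∧ W * (Wᵀ * M) = M ∧ W = M * K := by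
  let e := WithLp.linearEquiv 2 ℝ (Fin m → ℝ)
  let S : Submodule ℝ (EuclideanSpace ℝ (Fin m)) :=
    (LinearMap.range M.mulVecLin).comap e.toLinearMap
  have hS : Module.finrank ℝ S = M.rank := by
    have : S = (LinearMap.range M.mulVecLin).map e.symm.toLinearMap :=
      Submodule.comap_equiv_eq_map_symm e _
    rw [this]
    exact LinearEquiv.finrank_map_eq _ _
  let b : OrthonormalBasis (Fin M.rank) ℝ S :=
    (stdOrthonormalBasis ℝ S).reindex (finCongr hS)
  have hex : ∀ k, ∃ x, M *ᵥ x = e (b k) := fun k => (b k).2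
  choose x hx using hex
  refine ⟨Matrix.of fun i k => (b k : EuclideanSpace ℝ (Fin m)) i,
    Matrix.of fun j k => x k j, ?_, ?_, ?_⟩
  · ext k l
    have h := (orthonormal_iff_ite.1 b.orthonormal) k l
    rw [Submodule.coe_inner, PiLp.inner_apply] at h
    rw [Matrix.one_apply, ← h, Matrix.mul_apply]
    exact Finset.sum_congr rfl fun i _ => mul_comm _ _
  · ext i j
    have hmem : e.symm (M *ᵥ Pi.single j 1) ∈ S := ⟨Pi.single j 1, rfl⟩
    have h := congrArg (fun z : S => (z : EuclideanSpace ℝ (Fin m)) i)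
      (b.sum_repr' ⟨_, hmem⟩)
    have hcoe : (e.symm (M *ᵥ Pi.single j 1)) i = M i j := by
      change (M *ᵥ Pi.single j 1) i = M i j
      rw [Matrix.mulVec_single_one, Matrix.col_apply]
    simp only [Submodule.coe_sum, Submodule.coe_smul, Submodule.coe_inner, WithLp.ofLp_sum,
      Finset.sum_apply, WithLp.ofLp_smul, Pi.smul_apply, smul_eq_mul, hcoe] at h
    rw [← h, Matrix.mul_apply]
    refine Finset.sum_congr rfl fun k _ => ?_
    rw [Matrix.of_apply, mul_comm, Matrix.mul_apply, PiLp.inner_apply]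
    congr 1
    refine Finset.sum_congr rfl fun l _ => ?_
    rw [Matrix.transpose_apply, Matrix.of_apply, mul_comm]
    change _ = (M *ᵥ Pi.single j 1) l * _
    rw [Matrix.mulVec_single_one, Matrix.col_apply]
    rfl
  · ext i k
    rw [Matrix.mul_apply, Matrix.of_apply]
    exact (congrFun (hx k) i).symm

end FrobeniusInner

/-! ### Spectral stationarity and its consequence for the strong convexity lower model. -/

section SpectralStationarity

variable {m n r : ℕ}

/-- `X` has rank at most `r`, the gradient `G` is orthogonal to the row and column spaces of `X`,
and the operator norm of `G` is at most `β` times the `r`-th singular value of `X`. -/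
structure IsSpectrallyStationary (r : ℕ) (β : ℝ) (X G : Matrix (Fin m) (Fin n) ℝ) : Prop where
  rank_le : X.rank ≤ r
  mul_transpose : G * Xᵀ = 0
  transpose_mul : Xᵀ * G = 0
  eq_zero_of_rank_lt : X.rank < r → G = 0
  opNorm_le : ∀ (u : Fin m → ℝ) (x : Fin n → ℝ),
    ((u ᵥ* G) ⬝ᵥ (u ᵥ* G)) * ((X *ᵥ x) ⬝ᵥ (X *ᵥ x)) ≤
      β ^ 2 * (((X *ᵥ x) ᵥ* X) ⬝ᵥ ((X *ᵥ x) ᵥ* X)) * (u ⬝ᵥ u)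

theorem dotProduct_mulVec_of_orthonormal (W : Matrix (Fin m) (Fin r) ℝ) (hW : Wᵀ * W = 1)
    (y : Fin r → ℝ) : (W *ᵥ y) ⬝ᵥ (W *ᵥ y) = y ⬝ᵥ y := by
  rw [Matrix.dotProduct_mulVec, ← Matrix.mulVec_transpose, Matrix.mulVec_mulVec, hW,
    Matrix.one_mulVec]

theorem dotProduct_self_pos {u : Fin m → ℝ} (hu : u ≠ 0) : 0 < u ⬝ᵥ u :=
  lt_of_le_of_ne (Finset.sum_nonneg fun _ _ => mul_self_nonneg _)
    fun h => hu (dotProduct_self_eq_zero.1 h.symm)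

theorem dotProduct_self_nonneg' (u : Fin m → ℝ) : 0 ≤ u ⬝ᵥ u :=
  Finset.sum_nonneg fun _ _ => mul_self_nonneg _

/-- A threshold separating the squared singular values of `G` from those of `β X`. -/
theorem IsSpectrallyStationary.exists_threshold {β : ℝ} {X G : Matrix (Fin m) (Fin n) ℝ}
    (h : IsSpectrallyStationary r β X G) (hX : X ≠ 0) :
    ∃ c : ℝ, 0 ≤ c ∧ (∀ u, (u ᵥ* G) ⬝ᵥ (u ᵥ* G) ≤ c * (u ⬝ᵥ u)) ∧
      ∀ x, c * ((X *ᵥ x) ⬝ᵥ (X *ᵥ x)) ≤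
        β ^ 2 * (((X *ᵥ x) ᵥ* X) ⬝ᵥ ((X *ᵥ x) ᵥ* X)) := by
  obtain ⟨x₀, hx₀⟩ : ∃ x, X *ᵥ x ≠ 0 := by
    by_contra! hc
    exact hX (Matrix.ext_of_mulVec_single fun i => by rw [hc, Matrix.zero_mulVec])
  let s : Set ℝ := {a | ∃ u : Fin m → ℝ, u ≠ 0 ∧ a = (u ᵥ* G) ⬝ᵥ (u ᵥ* G) / (u ⬝ᵥ u)}
  let t : Set ℝ := {b | ∃ x, X *ᵥ x ≠ 0 ∧
    b = β ^ 2 * (((X *ᵥ x) ᵥ* X) ⬝ᵥ ((X *ᵥ x) ᵥ* X)) / ((X *ᵥ x) ⬝ᵥ (X *ᵥ x))}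
  have hs : s.Nonempty := ⟨_, X *ᵥ x₀, hx₀, rfl⟩
  have ht : t.Nonempty := ⟨_, x₀, hx₀, rfl⟩
  -- `opNorm_le` says every quotient in `s` is at most every quotient in `t`; order completeness
  -- supplies `c`, with no extremal singular vectors needed.
  obtain ⟨c, hcs, hct⟩ : (upperBounds s ∩ lowerBounds t).Nonempty := by
    refine exists_between_of_forall_le hs ht ?_
    rintro _ ⟨u, hu, rfl⟩ _ ⟨x, hx, rfl⟩
    rw [div_le_div_iff₀ (dotProduct_self_pos hu) (dotProduct_self_pos hx)]
    exact h.opNorm_le u x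
  refine ⟨c, ?_, fun u => ?_, fun x => ?_⟩
  · refine le_trans ?_ (hcs ⟨X *ᵥ x₀, hx₀, rfl⟩)
    exact div_nonneg (dotProduct_self_nonneg' _) (dotProduct_self_nonneg' _)
  · by_cases hu : u = 0
    · simp [hu]
    · exact (div_le_iff₀ (dotProduct_self_pos hu)).1 (hcs ⟨u, hu, rfl⟩)
  · by_cases hx : X *ᵥ x = 0
    · simp [hx]
    · exact (le_div_iff₀ (dotProduct_self_pos hx)).1 (hct ⟨x, hx, rfl⟩)

/-- The energy of `G` in an `s`-dimensional subspace is controlled by the energy of `X` outside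
of it. -/
theorem IsSpectrallyStationary.norm_proj_sq_le {α β : ℝ} (hα : 0 < α) (hαβ : α ≤ β)
    {X G : Matrix (Fin m) (Fin n) ℝ} (h : IsSpectrallyStationary r β X G) {s : ℕ}
    (hs : (s : ℝ) * β ^ 2 ≤ r * α ^ 2) {P : Matrix (Fin m) (Fin s) ℝ} (hP : Pᵀ * P = 1) :
    ‖Pᵀ * G‖ ^ 2 ≤ α ^ 2 * ‖X - P * (Pᵀ * X)‖ ^ 2 := by
  by_cases hG : G = 0
  · rw [hG, Matrix.mul_zero, norm_zero, zero_pow two_ne_zero]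
    positivity
  have hXr : X.rank = r := le_antisymm h.rank_le (not_lt.1 fun hlt => hG (h.eq_zero_of_rank_lt hlt))
  have hXr' : (X.rank : ℝ) = r := congrArg _ hXr
  by_cases hX : X = 0
  · have hr : r = 0 := by rw [← hXr, hX, Matrix.rank_zero]
    have hβ : 0 < β := hα.trans_le hαβ
    have hs0 : s = 0 := by
      by_contra hne
      have : (0 : ℝ) < s := by positivity
      have : 0 < (s : ℝ) * β ^ 2 := by positivity
      simp [hr] at hs
      linarith
    subst hs0
    have : Pᵀ * G = 0 := Subsingleton.elim _ _
    rw [this, norm_zero, zero_pow two_ne_zero]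
    positivity
  obtain ⟨c, hc, hcG, hcX⟩ := h.exists_threshold hX
  obtain ⟨W, K, hW, hWX, hWK⟩ := exists_orthonormal_factor X
  have hβ : 0 < β := hα.trans_le hαβ
  set p := ‖Pᵀ * W‖ ^ 2 with hp
  have hp0 : 0 ≤ p := by positivity
  have hWG : Wᵀ * G = 0 := by
    rw [hWK, Matrix.transpose_mul, Matrix.mul_assoc, h.transpose_mul, Matrix.mul_zero]
  -- Since `WᵀG = 0`, `P` may be replaced by `P - WWᵀP`, whose squared norm is `s - p`.
  have h1 : ‖Pᵀ * G‖ ^ 2 ≤ c * (s - p) := by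
    have e1 : Pᵀ * G = (P - W * (Wᵀ * P))ᵀ * G := by
      rw [Matrix.transpose_sub, Matrix.transpose_mul, Matrix.sub_mul, Matrix.mul_assoc _ Wᵀ, hWG,
        Matrix.mul_zero, sub_zero]
    have e2 : ‖Wᵀ * P‖ = ‖Pᵀ * W‖ := by
      rw [← norm_transpose_frob, Matrix.transpose_mul, Matrix.transpose_transpose]
    rw [e1]
    refine (norm_mul_sq_le hcG _).trans_eq ?_
    rw [norm_transpose_frob, norm_sq_sub_proj hW, norm_sq_of_orthonormal hP, e2]
  have h2 : c * (r - p) ≤ β ^ 2 * ‖X - P * (Pᵀ * X)‖ ^ 2 := by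
    have e1 : X - P * (Pᵀ * X) = (W - P * (Pᵀ * W)) * (Wᵀ * X) := by
      rw [Matrix.sub_mul, hWX, Matrix.mul_assoc, Matrix.mul_assoc Pᵀ, hWX]
    -- Taking `x = K u` gives `X x = W u`, a vector of the column space with the same length as `u`.
    have e2 : ∀ u, c / β ^ 2 * (u ⬝ᵥ u) ≤ (u ᵥ* (Wᵀ * X)) ⬝ᵥ (u ᵥ* (Wᵀ * X)) := by
      intro u
      have := hcX (K *ᵥ u)
      rw [Matrix.mulVec_mulVec, ← hWK, dotProduct_mulVec_of_orthonormal W hW] at this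
      rw [← Matrix.vecMul_vecMul, Matrix.vecMul_transpose, div_mul_eq_mul_div,
        div_le_iff₀ (by positivity), mul_comm _ (β ^ 2)]
      exact this
    have := le_norm_mul_sq e2 (W - P * (Pᵀ * W))
    rw [← e1, norm_sq_sub_proj hP, norm_sq_of_orthonormal hW, hXr', div_mul_eq_mul_div,
      div_le_iff₀ (by positivity), mul_comm _ (β ^ 2)] at this
    exact this
  -- Subtract `p α² ≤ p β²` from the rank condition; the signs of `s - p` and `r - p` play no role.
  have h3 : (s - p) * β ^ 2 ≤ (r - p) * α ^ 2 := by
    have : α ^ 2 ≤ β ^ 2 := by gcongr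
    nlinarith
  have h4 : β ^ 2 * ‖Pᵀ * G‖ ^ 2 ≤ β ^ 2 * (α ^ 2 * ‖X - P * (Pᵀ * X)‖ ^ 2) := by
    calc β ^ 2 * ‖Pᵀ * G‖ ^ 2 ≤ β ^ 2 * (c * (s - p)) := by gcongr
      _ = c * ((s - p) * β ^ 2) := by ring
      _ ≤ c * ((r - p) * α ^ 2) := by gcongr
      _ = α ^ 2 * (c * (r - p)) := by ring
      _ ≤ α ^ 2 * (β ^ 2 * ‖X - P * (Pᵀ * X)‖ ^ 2) := by gcongr
      _ = _ := by ring
  exact le_of_mul_le_mul_left h4 (by positivity)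

/-- Up to the factor `2α`, the expression is `‖αX - G - αY‖² - ‖G‖²`. The first term is at least the
energy of `αX - G` off the column space of `Y`, and orthogonality of `X` and `G` splits that energy
into the two quantities compared in `norm_proj_sq_le`. -/
theorem IsSpectrallyStationary.lower_model_nonneg {α β : ℝ} (hα : 0 < α) (hαβ : α ≤ β)
    {X G : Matrix (Fin m) (Fin n) ℝ} (h : IsSpectrallyStationary r β X G)
    {Y : Matrix (Fin m) (Fin n) ℝ} (hY : (Y.rank : ℝ) * β ^ 2 ≤ r * α ^ 2) :
    0 ≤ frobInner G (Y - X) + α / 2 * ‖X - Y‖ ^ 2 := by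
  obtain ⟨P, K, hP, hPY, -⟩ := exists_orthonormal_factor Y
  have key := h.norm_proj_sq_le hα hαβ hY hP
  have hGX : frobInner X G = 0 := by
    rw [frobInner_eq_trace, h.transpose_mul, Matrix.trace_zero]
  have hPGX : frobInner (Pᵀ * X) (Pᵀ * G) = 0 := by
    rw [← frobInner_mul_right, ← Matrix.mul_assoc, frobInner_comm, frobInner_eq_trace,
      Matrix.transpose_mul, Matrix.transpose_mul, Matrix.transpose_transpose, Matrix.mul_assoc,
      Matrix.trace_mul_comm, Matrix.mul_assoc, ← Matrix.transpose_transpose X,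
      ← Matrix.transpose_mul, h.mul_transpose]
    simp
  set Z := α • X - G with hZ
  have hZn : ‖Z‖ ^ 2 = α ^ 2 * ‖X‖ ^ 2 + ‖G‖ ^ 2 := by
    rw [hZ, norm_sub_sq_frob, frobInner_comm, frobInner_smul_right, frobInner_comm, hGX, norm_smul,
      mul_pow, Real.norm_eq_abs, sq_abs]
    ring
  have hPZn : ‖Pᵀ * Z‖ ^ 2 = α ^ 2 * ‖Pᵀ * X‖ ^ 2 + ‖Pᵀ * G‖ ^ 2 := by
    rw [hZ, Matrix.mul_sub, Matrix.mul_smul, norm_sub_sq_frob, frobInner_comm,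
      frobInner_smul_right, frobInner_comm, hPGX, norm_smul,
      mul_pow, Real.norm_eq_abs, sq_abs]
    ring
  have hproj : ‖Z‖ ^ 2 - ‖Pᵀ * Z‖ ^ 2 ≤ ‖Z - α • Y‖ ^ 2 := by
    -- The projection fixes `Y`, so shifting by `α • Y` leaves the residual unchanged.
    have e : Z - P * (Pᵀ * Z) = (Z - α • Y) - P * (Pᵀ * (Z - α • Y)) := by
      rw [Matrix.mul_sub _ Z, Matrix.mul_sub P, Matrix.mul_smul, Matrix.mul_smul, hPY]
      abel
    rw [← norm_sq_sub_proj hP, e, norm_sq_sub_proj hP]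
    linarith [sq_nonneg ‖Pᵀ * (Z - α • Y)‖]
  have hZY : ‖Z - α • Y‖ ^ 2 =
      α ^ 2 * ‖X - Y‖ ^ 2 + 2 * α * frobInner G (Y - X) + ‖G‖ ^ 2 := by
    have e : Z - α • Y = α • (X - Y) - G := by rw [hZ, smul_sub]; abel
    rw [e, norm_sub_sq_frob, frobInner_comm, frobInner_smul_right, norm_smul, mul_pow,
      Real.norm_eq_abs, sq_abs, frobInner_sub_right, frobInner_sub_right]
    ring
  rw [norm_sq_sub_proj hP] at key
  have : 0 ≤ 2 * α * (frobInner G (Y - X) + α / 2 * ‖X - Y‖ ^ 2) := by nlinarith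
  exact nonneg_of_mul_nonneg_right this (by positivity)

end SpectralStationarity

/-! ### Fixed points of projected gradient descent. -/

section ProjectedGradient

variable {m n r : ℕ}

theorem rank_sub_vecMulVec_le (M : Matrix (Fin m) (Fin n) ℝ) (u : Fin m → ℝ) (v : Fin n → ℝ) :
    (M - vecMulVec u v).rank ≤ M.rank + 1 := by
  have hle : LinearMap.range (M - vecMulVec u v).mulVecLin ≤
      LinearMap.range M.mulVecLin ⊔ LinearMap.range (vecMulVec u v).mulVecLin := by
    rintro _ ⟨x, rfl⟩
    rw [Matrix.mulVecLin_apply, Matrix.sub_mulVec]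
    exact Submodule.sub_mem _ (Submodule.mem_sup_left ⟨x, rfl⟩)
      (Submodule.mem_sup_right ⟨x, rfl⟩)
  exact (Submodule.finrank_mono hle).trans
    ((Submodule.finrank_add_le_finrank_add_finrank _ _).trans
      (Nat.add_le_add_left (Matrix.rank_vecMulVec_le u v) _))

/-- Projecting out a vector of the column space lowers the rank. -/
theorem rank_sub_vecMulVec_lt (X : Matrix (Fin m) (Fin n) ℝ) (x : Fin n → ℝ)
    (hx : (X *ᵥ x) ⬝ᵥ (X *ᵥ x) ≠ 0) :
    (X - vecMulVec (((X *ᵥ x) ⬝ᵥ (X *ᵥ x))⁻¹ • (X *ᵥ x)) ((X *ᵥ x) ᵥ* X)).rank < X.rank := by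
  set w := X *ᵥ x with hw
  set a := w ⬝ᵥ w with ha
  refine Submodule.finrank_lt_finrank_of_lt (lt_of_le_of_ne ?_ ?_)
  · rintro _ ⟨v, rfl⟩
    refine ⟨v - ((w ᵥ* X) ⬝ᵥ v) • a⁻¹ • x, ?_⟩
    simp [Matrix.mulVec_sub, Matrix.mulVec_smul, Matrix.vecMulVec_mulVec, ← hw,
      smul_comm (_ ⬝ᵥ v)]
  -- The vector `w` lies in the range of `X`, but everything in the range of the deflated matrix is
  -- orthogonal to `w`.
  · intro heq
    have hmem : w ∈ LinearMap.range (X - vecMulVec (a⁻¹ • w) (w ᵥ* X)).mulVecLin := by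
      rw [heq]; exact ⟨x, rfl⟩
    obtain ⟨v, hv⟩ := hmem
    apply hx
    have h1 := congrArg (w ⬝ᵥ ·) hv
    simp only [Matrix.mulVecLin_apply, Matrix.sub_mulVec, Matrix.vecMulVec_mulVec,
      dotProduct_sub, Matrix.dotProduct_mulVec, dotProduct_smul, ← ha, smul_eq_mul] at h1
    rw [← h1]
    simp [hx]

/-- A quadratic polynomial without constant term that is nonnegative has no linear term. -/
theorem eq_zero_of_forall_quadratic_nonneg {b c : ℝ} (h : ∀ t : ℝ, 0 ≤ t * b + t ^ 2 * c) :
    b = 0 := by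
  have hd := discrim_le_zero (a := c) (b := b) (c := 0) fun t => by linarith [h t]
  simp only [discrim, mul_zero, sub_zero] at hd
  exact pow_eq_zero_iff two_ne_zero |>.1 (le_antisymm hd (sq_nonneg b))

/-- Minimality is tested on competitors `X + D`. Multiples `t • (H * X)` and `t • (X * H)` keep the
rank bound for all `t`, which forces orthogonality; if the rank has slack, every rank-one `D` is
allowed and `G = 0`. The operator norm bound comes from exchanging a rank-one piece of `X` for a
rank-one descent step along `G`. -/
theorem IsRankProjection.isSpectrallyStationary {β : ℝ} (hβ : 0 < β)
    {X G : Matrix (Fin m) (Fin n) ℝ} (h : IsRankProjection r (X - (1 / β) • G) X) :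
    IsSpectrallyStationary r β X G := by
  obtain ⟨hXr, hmin⟩ := h
  have hmin' : ∀ D : Matrix (Fin m) (Fin n) ℝ, (X + D).rank ≤ r →
      0 ≤ 2 * β * frobInner G D + β ^ 2 * ‖D‖ ^ 2 := by
    intro D hD
    have h1 := hmin _ hD
    have e1 : X - (X - (1 / β) • G) = (1 / β) • G := by abel
    have e2 : X + D - (X - (1 / β) • G) = (1 / β) • G + D := by abel
    rw [e1, e2] at h1
    have h2 := pow_le_pow_left₀ (norm_nonneg _) h1 2
    rw [norm_add_sq_frob, frobInner_comm, frobInner_smul_right, frobInner_comm] at h2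
    have h3 : 0 ≤ 2 * (1 / β * frobInner G D) + ‖D‖ ^ 2 := by linarith
    have h4 : 2 * β * frobInner G D + β ^ 2 * ‖D‖ ^ 2 =
        β ^ 2 * (2 * (1 / β * frobInner G D) + ‖D‖ ^ 2) := by
      field_simp
    rw [h4]
    positivity
  have hGX : G * Xᵀ = 0 := by
    refine eq_zero_of_frobInner_eq_zero fun H => ?_
    rw [← frobInner_mul_right']
    have : 2 * β * frobInner G (H * X) = 0 := by
      refine eq_zero_of_forall_quadratic_nonneg (c := β ^ 2 * ‖H * X‖ ^ 2) fun t => ?_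
      have hrk : (X + t • (H * X)).rank ≤ r := by
        have : X + t • (H * X) = (1 + t • H) * X := by
          rw [Matrix.add_mul, Matrix.one_mul, Matrix.smul_mul]
        rw [this]
        exact (Matrix.rank_mul_le_right _ _).trans hXr
      have := hmin' _ hrk
      rw [frobInner_smul_right, norm_smul, mul_pow, Real.norm_eq_abs, sq_abs] at this
      linarith
    simpa [hβ.ne'] using this
  have hXG : Xᵀ * G = 0 := by
    refine eq_zero_of_frobInner_eq_zero fun H => ?_
    rw [← frobInner_mul_right]
    have : 2 * β * frobInner G (X * H) = 0 := by
      refine eq_zero_of_forall_quadratic_nonneg (c := β ^ 2 * ‖X * H‖ ^ 2) fun t => ?_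
      have hrk : (X + t • (X * H)).rank ≤ r := by
        have : X + t • (X * H) = X * (1 + t • H) := by
          rw [Matrix.mul_add, Matrix.mul_one, Matrix.mul_smul]
        rw [this]
        exact (Matrix.rank_mul_le_left _ _).trans hXr
      have := hmin' _ hrk
      rw [frobInner_smul_right, norm_smul, mul_pow, Real.norm_eq_abs, sq_abs] at this
      linarith
    simpa [hβ.ne'] using this
  refine ⟨hXr, hGX, hXG, fun hlt => ?_, fun u x => ?_⟩
  · refine eq_zero_of_frobInner_eq_zero fun H => ?_
    have hvec : ∀ u v, frobInner G (vecMulVec u v) = 0 := by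
      intro u v
      have : 2 * β * frobInner G (vecMulVec u v) = 0 := by
        refine eq_zero_of_forall_quadratic_nonneg
          (c := β ^ 2 * ‖vecMulVec u v‖ ^ 2) fun t => ?_
        have hrk : (X + t • vecMulVec u v).rank ≤ r := by
          have h1 := rank_sub_vecMulVec_le X (-t • u) v
          rw [Matrix.smul_vecMulVec, neg_smul, sub_neg_eq_add] at h1
          omega
        have := hmin' _ hrk
        rw [frobInner_smul_right, norm_smul, mul_pow, Real.norm_eq_abs, sq_abs] at this
        linarith
      simpa [hβ.ne'] using this
    have hG : ∀ i j, G i j = 0 := by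
      intro i j
      have := hvec (Pi.single i 1) (Pi.single j 1)
      rw [frobInner_vecMulVec] at this
      simpa using this
    simp [frobInner, hG]
  · by_cases hu : u = 0
    · simp [hu]
    by_cases hx : X *ᵥ x = 0
    · simp [hx]
    set w := X *ᵥ x with hw
    have ha := dotProduct_self_pos hx
    have hb := dotProduct_self_pos hu
    set a := w ⬝ᵥ w with ha'
    set b := u ⬝ᵥ u with hb'
    have horth : ∀ v z : Fin m → ℝ, (v ᵥ* G) ⬝ᵥ (z ᵥ* X) = 0 := by
      intro v z
      rw [← Matrix.mulVec_transpose X, Matrix.dotProduct_mulVec, Matrix.vecMul_vecMul, hGX]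
      simp
    set D₁ := vecMulVec (a⁻¹ • w) (w ᵥ* X) with hD₁
    -- Removing `D₁` frees one unit of rank and costs `β² ‖wᵀX‖² / a`. The factor `(β b)⁻¹` is the
    -- optimal step along `u (uᵀG)`, and its net gain is `‖uᵀG‖² / b`.
    set D₂ := vecMulVec ((β * b)⁻¹ • u) (u ᵥ* G) with hD₂
    have hrk : (X + -(D₁ + D₂)).rank ≤ r := by
      have h1 := rank_sub_vecMulVec_lt X x ha.ne'
      have h2 := rank_sub_vecMulVec_le (X - D₁) ((β * b)⁻¹ • u) (u ᵥ* G)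
      have e : X + -(D₁ + D₂) = X - D₁ - D₂ := by abel
      rw [e]
      exact h2.trans ((Nat.succ_le_of_lt h1).trans hXr)
    have h0 := hmin' _ hrk
    have hi1 : frobInner G D₁ = 0 := by
      rw [hD₁, frobInner_vecMulVec, horth]
    have hi2 : frobInner G D₂ = (β * b)⁻¹ * ((u ᵥ* G) ⬝ᵥ (u ᵥ* G)) := by
      rw [hD₂, frobInner_vecMulVec, Matrix.smul_vecMul, smul_dotProduct, smul_eq_mul]
    have hi3 : frobInner D₁ D₂ = 0 := by
      rw [frobInner_comm, hD₁, frobInner_vecMulVec, hD₂, Matrix.vecMul_vecMulVec, smul_dotProduct,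
        horth, smul_zero]
    have hn1 : ‖D₁‖ ^ 2 = a⁻¹ * ((w ᵥ* X) ⬝ᵥ (w ᵥ* X)) := by
      rw [hD₁, norm_sq_vecMulVec, smul_dotProduct, dotProduct_smul, ← ha', smul_eq_mul,
        smul_eq_mul, inv_mul_cancel₀ ha.ne', mul_one]
    have hn2 : ‖D₂‖ ^ 2 = (β ^ 2 * b)⁻¹ * ((u ᵥ* G) ⬝ᵥ (u ᵥ* G)) := by
      rw [hD₂, norm_sq_vecMulVec, smul_dotProduct, dotProduct_smul, ← hb', smul_eq_mul,
        smul_eq_mul]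
      field_simp
    have hneg : frobInner G (-(D₁ + D₂)) = -frobInner G (D₁ + D₂) := by
      rw [← neg_one_smul ℝ, frobInner_smul_right]
      ring
    rw [hneg, norm_neg, norm_add_sq_frob, frobInner_add_right, hi1, hi2, hi3, hn1, hn2] at h0
    have h1 : 0 ≤ β ^ 2 * ((w ᵥ* X) ⬝ᵥ (w ᵥ* X)) / a - ((u ᵥ* G) ⬝ᵥ (u ᵥ* G)) / b := by
      refine h0.trans_eq ?_
      field_simp
      ring
    exact (div_le_div_iff₀ hb ha).1 (sub_nonneg.1 h1)

end ProjectedGradient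

/-! ### Second-order conditions and derivatives of the factorized objective. -/

section Calculus

variable {m n r : ℕ}

theorem fderiv_eq_frobInner (f : Matrix (Fin m) (Fin n) ℝ → ℝ) (X H : Matrix (Fin m) (Fin n) ℝ) :
    fderiv ℝ f X H = frobInner (gradMatrix f X) H := by
  conv_lhs => rw [Matrix.matrix_eq_sum_single H]
  simp only [map_sum, frobInner, gradMatrix, Matrix.of_apply]
  refine Finset.sum_congr rfl fun i _ => Finset.sum_congr rfl fun j _ => ?_
  have : Matrix.single i j (H i j) = H i j • Matrix.single i j (1 : ℝ) := by
    rw [Matrix.smul_single, smul_eq_mul, mul_one]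
  rw [this, map_smul, smul_eq_mul, mul_comm]

/-- If `φ` is twice differentiable at a critical point with nonnegative second derivative, then
every quadratic upper model of `φ` there has nonnegative curvature. -/
theorem nonneg_of_le_quadratic_model {φ φ' ρ : ℝ → ℝ} {a : ℝ}
    (hφ : ∀ t, HasDerivAt φ (φ' t) t) (hφ' : HasDerivAt φ' a 0) (h0 : φ' 0 = 0) (ha : 0 ≤ a)
    (hρ : Continuous ρ) (hle : ∀ t, φ t ≤ φ 0 + t ^ 2 * ρ t) : 0 ≤ ρ 0 := by
  refine le_of_forall_pos_lt_add fun ε hε => ?_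
  have hlit := hasDerivAt_iff_isLittleO_nhds_zero.1 hφ'
  have hev := hlit.def hε
  have hρev : ∀ᶠ t in 𝓝 (0 : ℝ), ρ t < ρ 0 + ε / 2 :=
    hρ.continuousAt.eventually_lt continuousAt_const (by linarith)
  obtain ⟨δ, hδ, hball⟩ := Metric.eventually_nhds_iff.1 (hev.and hρev)
  -- Near `0` on the right, `φ' t ≥ (a - ε) t ≥ -ε t`. This replaces a second-order Taylor expansion
  -- and needs the second derivative only at `0`.
  have hmono : MonotoneOn (fun t => φ t + ε / 2 * t ^ 2) (Set.Icc 0 (δ / 2)) := by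
    have hd : ∀ t, HasDerivAt (fun t => φ t + ε / 2 * t ^ 2) (φ' t + ε * t) t := by
      intro t
      have := (hφ t).add ((hasDerivAt_pow 2 t).const_mul (ε / 2))
      refine this.congr_deriv ?_
      simp
      ring
    refine monotoneOn_of_deriv_nonneg (convex_Icc _ _)
      (fun t _ => (hd t).continuousAt.continuousWithinAt)
      (fun t _ => (hd t).differentiableAt.differentiableWithinAt) fun t ht => ?_
    rw [interior_Icc] at ht
    rw [(hd t).deriv]
    have hb := (hball (y := t) (by
      rw [Real.dist_eq, sub_zero, abs_of_pos ht.1]; linarith [ht.2])).1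
    rw [zero_add, h0, sub_zero, smul_eq_mul, Real.norm_eq_abs, Real.norm_eq_abs,
      abs_of_pos ht.1] at hb
    have := (abs_le.1 hb).1
    nlinarith [mul_nonneg ht.1.le ha]
  have h1 := hmono (Set.left_mem_Icc.2 (by positivity)) (Set.right_mem_Icc.2 (by positivity))
    (by positivity)
  have h2 := hle (δ / 2)
  have h3 := (hball (y := δ / 2) (by
    rw [Real.dist_eq, sub_zero, abs_of_pos (by positivity)]; linarith)).2
  simp only at h1
  have hpos : 0 < (δ / 2) ^ 2 := by positivity
  have h4 : 0 ≤ (δ / 2) ^ 2 * (ρ (δ / 2) + ε / 2) := by nlinarith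
  have h5 := nonneg_of_mul_nonneg_right h4 hpos
  linarith

/-- At a second-order stationary point, every quadratic upper model along a line has nonnegative
curvature. -/
theorem nonneg_of_le_quadratic_model_line {E : Type*} [NormedAddCommGroup E] [NormedSpace ℝ E]
    {g : E → ℝ} (hg : Differentiable ℝ g) (hg' : Differentiable ℝ (fderiv ℝ g)) {p d : E}
    (h1 : fderiv ℝ g p = 0) (h2 : 0 ≤ fderiv ℝ (fderiv ℝ g) p d d) {ρ : ℝ → ℝ}
    (hρ : Continuous ρ) (hle : ∀ t : ℝ, g (p + t • d) ≤ g p + t ^ 2 * ρ t) : 0 ≤ ρ 0 := by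
  have hline : ∀ t : ℝ, HasDerivAt (fun t : ℝ => p + t • d) d t := fun t => by
    simpa using ((hasDerivAt_id t).smul_const d).const_add p
  have hφ : ∀ t : ℝ, HasDerivAt (fun t : ℝ => g (p + t • d)) (fderiv ℝ g (p + t • d) d) t :=
    fun t => (hg _).hasFDerivAt.comp_hasDerivAt t (hline t)
  have hφ' : HasDerivAt (fun t : ℝ => fderiv ℝ g (p + t • d) d)
      (fderiv ℝ (fderiv ℝ g) p d d) 0 := by
    have h1 : HasFDerivAt (fderiv ℝ g) (fderiv ℝ (fderiv ℝ g) p) (p + (0 : ℝ) • d) := by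
      rw [zero_smul, add_zero]
      exact (hg' _).hasFDerivAt
    have h2 := h1.comp_hasDerivAt (0 : ℝ) (hline 0)
    simpa using h2.clm_apply (hasDerivAt_const (0 : ℝ) d)
  refine nonneg_of_le_quadratic_model hφ hφ' (by simp [h1]) h2 hρ fun t => ?_
  rw [zero_smul, add_zero]
  exact hle t

theorem isBoundedBilinearMap_mul_transpose :
    IsBoundedBilinearMap ℝ fun p : Matrix (Fin m) (Fin r) ℝ × Matrix (Fin n) (Fin r) ℝ =>
      p.1 * p.2ᵀ where
  add_left _ _ _ := Matrix.add_mul _ _ _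
  smul_left _ _ _ := Matrix.smul_mul _ _ _
  add_right _ _ _ := by simp only [Matrix.transpose_add, Matrix.mul_add]
  smul_right _ _ _ := by simp only [Matrix.transpose_smul, Matrix.mul_smul]
  bound := ⟨1, one_pos, fun A B => by
    rw [one_mul, ← norm_transpose_frob B]
    exact Matrix.frobenius_norm_mul _ _⟩

theorem hasFDerivAt_factorized {f : Matrix (Fin m) (Fin n) ℝ → ℝ} (hf : Differentiable ℝ f)
    (p : Matrix (Fin m) (Fin r) ℝ × Matrix (Fin n) (Fin r) ℝ) :
    HasFDerivAt (factorized f r)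
      ((fderiv ℝ f (p.1 * p.2ᵀ)).comp (isBoundedBilinearMap_mul_transpose.deriv p)) p :=
  HasFDerivAt.comp p (hf _).hasFDerivAt (isBoundedBilinearMap_mul_transpose.hasFDerivAt p)

theorem fderiv_factorized {f : Matrix (Fin m) (Fin n) ℝ → ℝ} (hf : Differentiable ℝ f)
    (p : Matrix (Fin m) (Fin r) ℝ × Matrix (Fin n) (Fin r) ℝ) :
    fderiv ℝ (factorized f r) p =
      (fderiv ℝ f (p.1 * p.2ᵀ)).comp (isBoundedBilinearMap_mul_transpose.deriv p) :=
  HasFDerivAt.fderiv (hasFDerivAt_factorized hf p)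

theorem fderiv_factorized_apply {f : Matrix (Fin m) (Fin n) ℝ → ℝ} (hf : Differentiable ℝ f)
    (A U : Matrix (Fin m) (Fin r) ℝ) (B V : Matrix (Fin n) (Fin r) ℝ) :
    fderiv ℝ (factorized f r) (A, B) (U, V) =
      frobInner (gradMatrix f (A * Bᵀ)) (A * Vᵀ + U * Bᵀ) := by
  rw [fderiv_factorized hf, ← fderiv_eq_frobInner]
  rfl

theorem differentiable_fderiv_factorized {f : Matrix (Fin m) (Fin n) ℝ → ℝ}
    (hf : TwiceDifferentiable f) : Differentiable ℝ (fderiv ℝ (factorized f r)) := by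
  have hb := isBoundedBilinearMap_mul_transpose (m := m) (n := n) (r := r)
  have hd : Differentiable ℝ hb.deriv := hb.isBoundedLinearMap_deriv.differentiable
  rw [funext (fderiv_factorized hf.1)]
  intro p
  exact DifferentiableAt.clm_comp
    (DifferentiableAt.comp p (hf.2 _) (hb.differentiableAt p)) (hd p)

end Calculus

/-! ### Second-order stationary points of the factorized problem. -/

section Factorized

variable {m n r : ℕ}

theorem IsFactorizedSOSP.mul_right_eq_zero {f : Matrix (Fin m) (Fin n) ℝ → ℝ}
    (hf : Differentiable ℝ f) {A : Matrix (Fin m) (Fin r) ℝ} {B : Matrix (Fin n) (Fin r) ℝ}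
    (h : IsFactorizedSOSP f r (A, B)) : gradMatrix f (A * Bᵀ) * B = 0 := by
  refine eq_zero_of_frobInner_eq_zero fun U => ?_
  have := fderiv_factorized_apply hf A U B 0
  rw [h.1, Matrix.transpose_zero, Matrix.mul_zero, zero_add, frobInner_mul_right',
    Matrix.transpose_transpose] at this
  exact this.symm

theorem IsFactorizedSOSP.transpose_mul_eq_zero {f : Matrix (Fin m) (Fin n) ℝ → ℝ}
    (hf : Differentiable ℝ f) {A : Matrix (Fin m) (Fin r) ℝ} {B : Matrix (Fin n) (Fin r) ℝ}
    (h : IsFactorizedSOSP f r (A, B)) : Aᵀ * gradMatrix f (A * Bᵀ) = 0 := by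
  refine eq_zero_of_frobInner_eq_zero fun V => ?_
  have := fderiv_factorized_apply hf A 0 B Vᵀ
  rw [h.1, Matrix.transpose_transpose, Matrix.zero_mul, add_zero, frobInner_mul_right] at this
  exact this.symm

theorem rank_mul_transpose_le (A : Matrix (Fin m) (Fin r) ℝ) (B : Matrix (Fin n) (Fin r) ℝ) :
    (A * Bᵀ).rank ≤ r :=
  (Matrix.rank_mul_le_left _ _).trans (Matrix.rank_le_width A)

/-- Along `(A + tU, B + tV)` the product always has rank at most `r`, so restricted smoothness
applies. The linear term vanishes by stationarity, leaving an upper model `t² ρ(t)` whose value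
`ρ(0)` is the expression here; the Hessian is never expanded. -/
theorem IsFactorizedSOSP.curvature_nonneg {f : Matrix (Fin m) (Fin n) ℝ → ℝ}
    (hf : TwiceDifferentiable f) {β : ℝ} (hsm : RestrictedSmooth f r β)
    {A : Matrix (Fin m) (Fin r) ℝ} {B : Matrix (Fin n) (Fin r) ℝ}
    (h : IsFactorizedSOSP f r (A, B)) (U : Matrix (Fin m) (Fin r) ℝ)
    (V : Matrix (Fin n) (Fin r) ℝ) :
    0 ≤ frobInner (gradMatrix f (A * Bᵀ)) (U * Vᵀ) + β / 2 * ‖A * Vᵀ + U * Bᵀ‖ ^ 2 := by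
  set G := gradMatrix f (A * Bᵀ) with hG
  set D := A * Vᵀ + U * Bᵀ with hD
  have hcont : Continuous fun t : ℝ => frobInner G (U * Vᵀ) +
      β / 2 * ‖D + t • (U * Vᵀ)‖ ^ 2 := by fun_prop
  have hGD : frobInner G D = 0 := by
    rw [← fderiv_factorized_apply hf.1, h.1]
    rfl
  have hle : ∀ t : ℝ, factorized f r ((A, B) + t • (U, V)) ≤ factorized f r (A, B) +
      t ^ 2 * (frobInner G (U * Vᵀ) + β / 2 * ‖D + t • (U * Vᵀ)‖ ^ 2) := by
    intro t
    have hs := hsm (A * Bᵀ) ((A + t • U) * (B + t • V)ᵀ) (rank_mul_transpose_le _ _)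
      (rank_mul_transpose_le _ _)
    have e : (A + t • U) * (B + t • V)ᵀ - A * Bᵀ = t • (D + t • (U * Vᵀ)) := by
      rw [hD, Matrix.transpose_add, Matrix.transpose_smul, Matrix.mul_add, Matrix.add_mul,
        Matrix.add_mul, Matrix.mul_smul, Matrix.mul_smul, Matrix.smul_mul, Matrix.smul_mul,
        smul_add, smul_add]
      abel
    rw [norm_sub_rev, e, frobInner_smul_right, frobInner_add_right, frobInner_smul_right, ← hG,
      hGD, norm_smul, mul_pow, Real.norm_eq_abs, sq_abs] at hs
    refine hs.trans_eq ?_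
    change f (A * Bᵀ) + _ + _ = f (A * Bᵀ) + _
    ring
  have := nonneg_of_le_quadratic_model_line
    (fun p => (hasFDerivAt_factorized hf.1 p).differentiableAt)
    (differentiable_fderiv_factorized hf) h.1 (h.2 (U, V)) hcont hle
  simpa using this

/-- First-order stationarity gives orthogonality, and well-chosen rank-one `U`, `V` in
`curvature_nonneg` give the rest. The factors need not be balanced. -/
theorem IsFactorizedSOSP.isSpectrallyStationary {f : Matrix (Fin m) (Fin n) ℝ → ℝ}
    (hf : TwiceDifferentiable f) {β : ℝ} (hβ : 0 < β) (hsm : RestrictedSmooth f r β)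
    {A : Matrix (Fin m) (Fin r) ℝ} {B : Matrix (Fin n) (Fin r) ℝ}
    (h : IsFactorizedSOSP f r (A, B)) :
    IsSpectrallyStationary r β (A * Bᵀ) (gradMatrix f (A * Bᵀ)) := by
  have hGB := h.mul_right_eq_zero hf.1
  have hAG := h.transpose_mul_eq_zero hf.1
  have hcurv := h.curvature_nonneg hf hsm
  set G := gradMatrix f (A * Bᵀ)
  refine ⟨rank_mul_transpose_le _ _, ?_, ?_, fun hlt => ?_, fun u x => ?_⟩
  · rw [Matrix.transpose_mul, Matrix.transpose_transpose, ← Matrix.mul_assoc, hGB,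
      Matrix.zero_mul]
  · rw [Matrix.transpose_mul, Matrix.transpose_transpose, Matrix.mul_assoc, hAG, Matrix.mul_zero]
  -- With `U = u zᵀ` and `V = v zᵀ`, a kernel vector `z` kills `A * Vᵀ` or `U * Bᵀ`. Scaling the
  -- factor that survives in the quadratic term then makes that term second order in `t`, while the
  -- gradient term stays linear.
  · have hker : ∃ z : Fin r → ℝ, z ≠ 0 ∧ (A *ᵥ z = 0 ∨ B *ᵥ z = 0) := by
      by_contra! hc
      have hA : Function.Injective A.mulVecLin :=
        (injective_iff_map_eq_zero _).2 fun z hz => by_contra fun hne => (hc z hne).1 hz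
      have hB : Function.Injective B.mulVecLin :=
        (injective_iff_map_eq_zero _).2 fun z hz => by_contra fun hne => (hc z hne).2 hz
      have hBr : Bᵀ.rank = r := by
        rw [Matrix.rank_transpose, Matrix.rank, LinearMap.finrank_range_of_inj hB]
        simp
      have : (A * Bᵀ).rank = Bᵀ.rank := by
        rw [Matrix.rank, Matrix.mulVecLin_mul, LinearMap.range_comp]
        exact (Submodule.equivMapOfInjective _ hA _).finrank_eq.symm
      omega
    obtain ⟨z, hz, hz'⟩ := hker
    have hzz := dotProduct_self_pos hz
    have hvec : ∀ u v, frobInner G (vecMulVec u v) = 0 := by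
      intro u v
      have hUV : vecMulVec u z * (vecMulVec v z)ᵀ = (z ⬝ᵥ z) • vecMulVec u v := by
        rw [Matrix.transpose_vecMulVec, Matrix.vecMulVec_mul_vecMulVec, Matrix.vecMulVec_smul]
      have : (z ⬝ᵥ z) * frobInner G (vecMulVec u v) = 0 := by
        rcases hz' with hA | hB
        · have hAV : A * (vecMulVec v z)ᵀ = 0 := by
            rw [Matrix.transpose_vecMulVec, Matrix.mul_vecMulVec, hA, Matrix.zero_vecMulVec]
          refine eq_zero_of_forall_quadratic_nonneg
            (c := β / 2 * ‖vecMulVec u z * Bᵀ‖ ^ 2) fun t => ?_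
          have := hcurv (t • vecMulVec u z) (vecMulVec v z)
          rw [hAV, zero_add, Matrix.smul_mul, Matrix.smul_mul, hUV, frobInner_smul_right,
            frobInner_smul_right, norm_smul, mul_pow, Real.norm_eq_abs, sq_abs] at this
          linarith
        · have hUB : vecMulVec u z * Bᵀ = 0 := by
            rw [Matrix.vecMulVec_mul, Matrix.vecMul_transpose, hB]
            ext
            simp [vecMulVec_apply]
          refine eq_zero_of_forall_quadratic_nonneg
            (c := β / 2 * ‖A * (vecMulVec v z)ᵀ‖ ^ 2) fun t => ?_
          have := hcurv (vecMulVec u z) (t • vecMulVec v z)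
          rw [hUB, add_zero, Matrix.transpose_smul, Matrix.mul_smul, Matrix.mul_smul, hUV,
            frobInner_smul_right, frobInner_smul_right, norm_smul, mul_pow, Real.norm_eq_abs,
            sq_abs] at this
          linarith
      exact (mul_eq_zero.1 this).resolve_left hzz.ne'
    ext i j
    have := hvec (Pi.single i 1) (Pi.single j 1)
    rw [frobInner_vecMulVec] at this
    simpa using this
  · set w := (A * Bᵀ) *ᵥ x with hw
    set v := u ᵥ* G with hv
    set q := w ᵥ* (A * Bᵀ) with hq
    have hwA : A *ᵥ (Bᵀ *ᵥ x) = w := by rw [Matrix.mulVec_mulVec]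
    have hqB : B *ᵥ (w ᵥ* A) = q := by
      rw [← Matrix.vecMul_transpose, Matrix.vecMul_vecMul]
    have hab : (w ᵥ* A) ⬝ᵥ (Bᵀ *ᵥ x) = w ⬝ᵥ w := by
      rw [← Matrix.dotProduct_mulVec, hwA]
    have hvq : v ⬝ᵥ q = 0 := by
      rw [← hqB, Matrix.dotProduct_mulVec, hv, Matrix.vecMul_vecMul, hGB]
      simp
    -- The inner vectors are chosen so that `A * Vᵀ` is a multiple of `w vᵀ`, `U * Bᵀ = u qᵀ`, and
    -- their pairing is `w ⬝ᵥ w`. The scale `1 / β` minimizes the resulting quadratic, and `v ⬝ᵥ q =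
    -- 0` removes the cross term.
    have hc := hcurv (vecMulVec u (w ᵥ* A)) (vecMulVec (-(1 / β) • v) (Bᵀ *ᵥ x))
    have hUV : frobInner G (vecMulVec u (w ᵥ* A) * (vecMulVec (-(1 / β) • v) (Bᵀ *ᵥ x))ᵀ) =
        -(1 / β) * ((w ⬝ᵥ w) * (v ⬝ᵥ v)) := by
      rw [Matrix.transpose_vecMulVec, Matrix.vecMulVec_mul_vecMulVec, hab, frobInner_vecMulVec,
        dotProduct_smul, dotProduct_smul, smul_eq_mul, smul_eq_mul]
      ring
    have hD : ‖A * (vecMulVec (-(1 / β) • v) (Bᵀ *ᵥ x))ᵀ + vecMulVec u (w ᵥ* A) * Bᵀ‖ ^ 2 =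
        (1 / β) ^ 2 * ((w ⬝ᵥ w) * (v ⬝ᵥ v)) + (u ⬝ᵥ u) * (q ⬝ᵥ q) := by
      rw [Matrix.transpose_vecMulVec, Matrix.mul_vecMulVec, hwA, Matrix.vecMulVec_mul,
        Matrix.vecMul_transpose, hqB, norm_add_sq_frob, frobInner_vecMulVec,
        Matrix.vecMul_vecMulVec, norm_sq_vecMulVec, norm_sq_vecMulVec]
      simp only [smul_dotProduct, dotProduct_smul, smul_eq_mul, hvq]
      ring
    rw [hUV, hD] at hc
    have h1 : 0 ≤ (1 / (2 * β)) * (β ^ 2 * (q ⬝ᵥ q) * (u ⬝ᵥ u) - (v ⬝ᵥ v) * (w ⬝ᵥ w)) := by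
      refine hc.trans_eq ?_
      field_simp
      ring
    exact sub_nonneg.1 (nonneg_of_mul_nonneg_right h1 (by positivity))

end Factorized

/-! ### Existence of the minimum and comparison of the constants. -/

section Attainment

variable {m n r : ℕ}

/-- Ranks are integers, so the complement is `⌈c⌉₊ ≤ rank`, which is open by lower semicontinuity of
the rank. -/
theorem isClosed_setOf_rank_lt (c : ℝ) :
    IsClosed {Y : Matrix (Fin m) (Fin n) ℝ | (Y.rank : ℝ) < c} := by
  let T : Matrix (Fin m) (Fin n) ℝ →ₗ[ℝ] ((Fin n → ℝ) →L[ℝ] (Fin m → ℝ)) :=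
    LinearMap.toContinuousLinearMap.toLinearMap ∘ₗ (Matrix.toLin' (R := ℝ)).toLinearMap
  have hT : Continuous T := T.continuous_of_finiteDimensional
  rw [← isOpen_compl_iff]
  convert (isOpen_setOfPred_nat_le_rank (𝕜 := ℝ) (E := Fin n → ℝ)
    (F := Fin m → ℝ) ⌈c⌉₊).preimage hT using 1
  ext Y
  have hrank : ((T Y : (Fin n → ℝ) →L[ℝ] (Fin m → ℝ)) : (Fin n → ℝ) →ₗ[ℝ] (Fin m → ℝ)).rank =
      (Y.rank : Cardinal) := (Module.finrank_eq_rank ℝ (LinearMap.range (Matrix.toLin' Y))).symm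
  simp only [Set.mem_compl_iff, Set.mem_ofPred_eq, not_lt, Set.mem_preimage, hrank, Nat.cast_le,
    Nat.ceil_le]

theorem exists_isLeast_image_rank_lt {f : Matrix (Fin m) (Fin n) ℝ → ℝ} (hf : Continuous f)
    {α : ℝ} (hα : 0 < α) (hsc : RestrictedStronglyConvex f r α) {c : ℝ} (hc : 0 < c)
    (hcr : ∀ Y : Matrix (Fin m) (Fin n) ℝ, (Y.rank : ℝ) < c → Y.rank ≤ r) :
    ∃ μ, IsLeast (f '' {Y : Matrix (Fin m) (Fin n) ℝ | (Y.rank : ℝ) < c}) μ := by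
  set S := {Y : Matrix (Fin m) (Fin n) ℝ | (Y.rank : ℝ) < c} with hS
  have h0 : (0 : Matrix (Fin m) (Fin n) ℝ) ∈ S := by
    simpa [hS, Matrix.rank_zero] using hc
  set G := gradMatrix f 0 with hG
  have : ProperSpace (Matrix (Fin m) (Fin n) ℝ) := FiniteDimensional.proper ℝ _
  have hcl : IsClosed (S ∩ {Y | f Y ≤ f 0}) :=
    (isClosed_setOf_rank_lt c).inter (isClosed_le hf continuous_const)
  -- Completing the square in strong convexity at `0` gives this ball, so the sublevel set is
  -- compact.
  have hsub : S ∩ {Y | f Y ≤ f 0} ⊆ Metric.closedBall (-(1 / α) • G) (‖(1 / α) • G‖) := by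
    rintro Y ⟨hY, hfY⟩
    have h := hsc 0 Y (hcr 0 h0) (hcr Y hY)
    rw [sub_zero, zero_sub, norm_neg] at h
    have hfY' : f Y ≤ f 0 := hfY
    rw [Metric.mem_closedBall, dist_eq_norm, neg_smul, sub_neg_eq_add]
    refine pow_le_pow_iff_left₀ (norm_nonneg _) (norm_nonneg _) two_ne_zero |>.1 ?_
    rw [norm_add_sq_frob, frobInner_smul_right, frobInner_comm]
    have h2 : ‖Y‖ ^ 2 + 2 * (1 / α * frobInner G Y) =
        2 / α * (frobInner G Y + α / 2 * ‖Y‖ ^ 2) := by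
      field_simp
      ring
    have h3 : 2 / α * (frobInner G Y + α / 2 * ‖Y‖ ^ 2) ≤ 0 :=
      mul_nonpos_of_nonneg_of_nonpos (by positivity) (by linarith)
    linarith
  have hcomp := (isCompact_closedBall _ _).of_isClosed_subset hcl hsub
  obtain ⟨Y, hY, hmin⟩ := hcomp.exists_isMinOn ⟨0, h0, le_refl (f 0)⟩ hf.continuousOn
  refine ⟨f Y, ⟨Y, hY.1, rfl⟩, ?_⟩
  rintro _ ⟨Z, hZ, rfl⟩
  by_cases hZ0 : f Z ≤ f 0
  · exact hmin ⟨hZ, hZ0⟩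
  · exact hY.2.trans (not_le.1 hZ0).le

/-- Both inequalities are compared at `0` and a unit rank-one matrix. The indices `i`, `j` are
essential: on an empty matrix space the constants are unrelated. -/
theorem strongConvexity_le_smoothness {f : Matrix (Fin m) (Fin n) ℝ → ℝ} (hr : 0 < r) {α β : ℝ}
    (hsc : RestrictedStronglyConvex f r α) (hsm : RestrictedSmooth f r β) (i : Fin m)
    (j : Fin n) : α ≤ β := by
  set E : Matrix (Fin m) (Fin n) ℝ := vecMulVec (Pi.single i 1) (Pi.single j 1) with hE
  have hE1 : ‖E‖ ^ 2 = 1 := by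
    rw [hE, norm_sq_vecMulVec]
    simp
  have hEr : E.rank ≤ r := (Matrix.rank_vecMulVec_le _ _).trans hr
  have h0r : (0 : Matrix (Fin m) (Fin n) ℝ).rank ≤ r := by simp
  have h1 := hsc 0 E h0r hEr
  have h2 := hsm 0 E h0r hEr
  rw [zero_sub, norm_neg, hE1] at h1 h2
  linarith

theorem IsSpectrallyStationary.le_of_rank_lt {f : Matrix (Fin m) (Fin n) ℝ → ℝ} {α β : ℝ}
    (hα : 0 < α) (hαβ : α ≤ β) (hsc : RestrictedStronglyConvex f r α)
    {X Y : Matrix (Fin m) (Fin n) ℝ} (h : IsSpectrallyStationary r β X (gradMatrix f X))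
    (hYr : Y.rank ≤ r) (hY : (Y.rank : ℝ) * β ^ 2 ≤ r * α ^ 2) : f X ≤ f Y := by
  have h1 := hsc X Y h.rank_le hYr
  have h2 := h.lower_model_nonneg hα hαβ hY
  linarith

end Attainment

end LowRankOpt

theorem theorem4 (m n r : ℕ) (hr : 0 < r) (f : Matrix (Fin m) (Fin n) ℝ → ℝ)
    (hf : LowRankOpt.TwiceDifferentiable f)
    (α β κ : ℝ) (hα : 0 < α) (hβ : 0 < β) (hκ : κ = β / α)
    (hRSC : LowRankOpt.RestrictedStronglyConvex f r α)
    (hRSM : LowRankOpt.RestrictedSmooth f r β) :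
    ∃ μ : ℝ,
      IsLeast (f '' {Y : Matrix (Fin m) (Fin n) ℝ | (Y.rank : ℝ) < (r : ℝ) / κ ^ 2}) μ ∧
      (∀ X : Matrix (Fin m) (Fin n) ℝ, LowRankOpt.IsPGDStationary f r (1 / β) X → f X ≤ μ) ∧
      (∀ (A : Matrix (Fin m) (Fin r) ℝ) (B : Matrix (Fin n) (Fin r) ℝ),
        LowRankOpt.IsFactorizedSOSP f r (A, B) → f (A * B.transpose) ≤ μ) := by
  have hr' : (0 : ℝ) < r := by exact_mod_cast hr
  have hκ0 : 0 < κ := hκ ▸ div_pos hβ hα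
  have hc : 0 < (r : ℝ) / κ ^ 2 := by positivity
  have hdim : ∀ Y : Matrix (Fin m) (Fin n) ℝ, 0 < Y.rank → α ≤ β := by
    intro Y hY
    have hm := hY.trans_le (Matrix.rank_le_height Y)
    have hn := hY.trans_le (Matrix.rank_le_width Y)
    exact LowRankOpt.strongConvexity_le_smoothness hr hRSC hRSM ⟨0, hm⟩ ⟨0, hn⟩
  have hbudget : ∀ Y : Matrix (Fin m) (Fin n) ℝ, (Y.rank : ℝ) < r / κ ^ 2 →
      (Y.rank : ℝ) * β ^ 2 ≤ r * α ^ 2 := by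
    intro Y hY
    rw [hκ, div_pow, div_div_eq_mul_div, lt_div_iff₀ (by positivity)] at hY
    exact hY.le
  have hrank : ∀ Y : Matrix (Fin m) (Fin n) ℝ, (Y.rank : ℝ) < r / κ ^ 2 → Y.rank ≤ r := by
    intro Y hY
    rcases Nat.eq_zero_or_pos Y.rank with h0 | hpos
    -- Rank zero is separate because `α ≤ β` may fail when there are no entries.
    · omega
    have h1 := hbudget Y hY
    have h2 : α ^ 2 ≤ β ^ 2 := pow_le_pow_left₀ hα.le (hdim Y hpos) 2
    have h3 : (Y.rank : ℝ) * β ^ 2 ≤ r * β ^ 2 := h1.trans (by gcongr)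
    exact_mod_cast le_of_mul_le_mul_right h3 (by positivity)
  obtain ⟨μ, hμ⟩ := LowRankOpt.exists_isLeast_image_rank_lt hf.1.continuous hα hRSC hc hrank
  have hmain : ∀ X, LowRankOpt.IsSpectrallyStationary r β X (LowRankOpt.gradMatrix f X) →
      f X ≤ μ := by
    intro X hX
    obtain ⟨Y, hY, rfl⟩ := hμ.1
    by_cases hαβ : α ≤ β
    · exact hX.le_of_rank_lt hα hαβ hRSC (hrank Y hY) (hbudget Y hY)
    -- If `β < α`, the matrices have no entries and the space is a single point.
    · have hzero : ∀ Z : Matrix (Fin m) (Fin n) ℝ, Z = 0 := by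
        intro Z
        ext i j
        exact absurd (LowRankOpt.strongConvexity_le_smoothness hr hRSC hRSM i j) hαβ
      rw [hzero X, hzero Y]
  exact ⟨μ, hμ, fun X hX => hmain X (LowRankOpt.IsRankProjection.isSpectrallyStationary hβ hX),
    fun A B hAB => hmain _ (hAB.isSpectrallyStationary hf hβ hRSM)⟩
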